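/- Let $n\ge 1$, and write points of $\mathbb H^n$ as $q=(q_1,q')$ with $q_1\in\mathbb H$, $q'=(q_2,\dots,q_n)\in\mathbb H^{n-1}$. Put $\langle p',q'\rangle=\sum_{k=2}^n\overline{p_k}\,q_k$, $|q'|^2=\langle q',q'\rangle$, $\mathcal U_n=\{q\in\mathbb H^n:\operatorname{Re}q_1>|q'|^2\}$ and $\partial\mathcal U_n=\{q:\operatorname{Re}q_1=|q'|^2\}$. Let $\beta$ be the measure on $\partial\mathcal U_n$ that corresponds to Lebesgue measure on $\operatorname{Im}\mathbb H\times\mathbb H^{n-1}\cong\mathbb R^{3}\times\mathbb R^{4(n-1)}$ under $(q_1,q')\mapsto(\operatorname{Im}q_1,q')$. A $C^1$ function $F:\mathcal U_n\to\mathbb H$ is regular if, for $l=1,\dots,n$, $\bar\partial_{q_l}F=(\partial_{x_{4l-3}}+\mathbf i\,\partial_{x_{4l-2}}+\mathbf j\,\partial_{x_{4l-1}}+\mathbf k\,\partial_{x_{4l}})F=0$ on $\mathcal U_n$, where $q_l=x_{4l-3}+x_{4l-2}\mathbf i+x_{4l-1}\mathbf j+x_{4l}\mathbf k$. With $\mathbf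 e=(1,0,\dots,0)$ and $F_\varepsilon(q)=F(q+\varepsilon\mathbf e)$, the Hardy space $H^2(\mathcal U_n)$ consists of the regular $F$ with $\sup_{\varepsilon>0}\int_{\partial\mathcal U_n}|F_\varepsilon|^2\,d\beta<\infty$; the boundary value $F^b$ of such an $F$ is the limit of $F_\varepsilon$ in $L^2(\partial\mathcal U_n,\beta)$ as $\varepsilon\to0^+$. The Cauchy–Szegő kernel is the function $S:\mathcal U_n\times\mathcal U_n\to\mathbb H$ such that (1) $S(\cdot,p)\in H^2(\mathcal U_n)$ for every $p\in\mathcal U_n$; (2) $S(q,p)=\overline{S(p,q)}$ for all $q,p\in\mathcal U_n$; (3) $F(q)=\int_{\partial\mathcal U_n}S_b(q,Q)\,F^b(Q)\,d\beta(Q)$ for all $F\in H^2(\mathcal U_n)$ and $q\in\mathcal U_n$, where $S_b(q,\cdot)$ is the boundary value of $S(q,\cdot)$. Proposition. For all $q,Q\in\mathcal U_n$ the following hold. (i) $S(\tau_p(q),\tau_p(Q))=S(q,Q)$ for every $p\in\partial\mathcal U_n$, where $\tau_p(q_1,q')=(q_1+p_1+2\langle p',q'\rangle,\;q'+p')$.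 (ii) $S(R_{\mathbf a}(q),R_{\mathbf a}(Q))=S(q,Q)$ for every $\mathbf a\in\mathrm{Sp}(n-1)$ (quaternionic $(n-1)\times(n-1)$ matrices with $\mathbf a^*\mathbf a=\mathbf a\mathbf a^*=1$), where $R_{\mathbf a}(q_1,q')=(q_1,\mathbf a q')$. (iii) $\sigma\,S(R_\sigma(q),R_\sigma(Q))\,\overline\sigma=S(q,Q)$ for every $\sigma\in\mathbb H$ with $|\sigma|=1$, where $R_\sigma(q_1,q')=(\overline\sigma q_1\sigma,\;q'\sigma)$. (iv) $S(\delta_r(q),\delta_r(Q))\,r^{4n+2}=S(q,Q)$ for every $r>0$, where $\delta_r(q_1,q')=(r^2q_1,\;rq')$. -/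

import Mathlib

open MeasureTheory Filter Topology
open scoped Quaternion ENNReal

/-- The Borel structure on the quaternions.  With it, Mathlib equips `ℍ` with the
Lebesgue measure of the four real coordinates. -/
noncomputable instance quaternionMeasurableSpace : MeasurableSpace ℍ[ℝ] := borel ℍ[ℝ]

instance quaternionBorelSpace : BorelSpace ℍ[ℝ] := ⟨rfl⟩

/-- `ℍⁿ` for `n ≥ 1`, its points being written `q = (q₁, q')` with `q' ∈ ℍⁿ⁻¹`. -/
abbrev QSpace (n : ℕ) : Type := ℍ[ℝ] × (Fin (n - 1) → ℍ[ℝ])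

namespace QSiegel

noncomputable section

/-- The quaternion `x₁ + x₂ 𝐢 + x₃ 𝐣 + x₄ 𝐤`. -/
def quat (x₁ x₂ x₃ x₄ : ℝ) : ℍ[ℝ] := ⟨x₁, x₂, x₃, x₄⟩

@[simp] theorem quat_re (x₁ x₂ x₃ x₄ : ℝ) : (quat x₁ x₂ x₃ x₄).re = x₁ := rfl

@[simp] theorem quat_imI (x₁ x₂ x₃ x₄ : ℝ) : (quat x₁ x₂ x₃ x₄).imI = x₂ := rfl

@[simp] theorem quat_imJ (x₁ x₂ x₃ x₄ : ℝ) : (quat x₁ x₂ x₃ x₄).imJ = x₃ := rfl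

@[simp] theorem quat_imK (x₁ x₂ x₃ x₄ : ℝ) : (quat x₁ x₂ x₃ x₄).imK = x₄ := rfl

/-- `⟨p', q'⟩ = ∑ conj(p'_k) q'_k`. -/
def hInner {m : ℕ} (p q : Fin m → ℍ[ℝ]) : ℍ[ℝ] := ∑ k, star (p k) * q k

/-- `|q'|² = ∑ |q'_k|²`. -/
def sqNorm {m : ℕ} (q : Fin m → ℍ[ℝ]) : ℝ := ∑ k, ‖q k‖ ^ 2

/-- The quaternionic Siegel upper half space `Re q₁ > |q'|²`. -/
def upperHalfSpace (n : ℕ) : Set (QSpace n) := {q | sqNorm q.2 < q.1.re}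

/-- The hypersurface `Re q₁ = |q'|²`. -/
def bdry (n : ℕ) : Set (QSpace n) := {q | q.1.re = sqNorm q.2}

/-! ### Transformations -/

/-- The translate `τ_p`. -/
def translate {n : ℕ} (p q : QSpace n) : QSpace n :=
  (q.1 + p.1 + 2 * hInner p.2 q.2, q.2 + p.2)

/-- The rotation `R_𝐚 (q₁, q') = (q₁, 𝐚 q')`. -/
def rotMatrix {n : ℕ} (a : Matrix (Fin (n - 1)) (Fin (n - 1)) ℍ[ℝ]) (q : QSpace n) : QSpace n :=
  (q.1, a.mulVec q.2)

/-- The rotation `R_σ (q₁, q') = (conj(σ) q₁ σ, q' σ)`. -/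
def rotUnit {n : ℕ} (σ : ℍ[ℝ]) (q : QSpace n) : QSpace n :=
  (star σ * q.1 * σ, fun k => q.2 k * σ)

/-- The dilation `δ_r (q₁, q') = (r² q₁, r q')`. -/
def dilate {n : ℕ} (r : ℝ) (q : QSpace n) : QSpace n := (r ^ 2 • q.1, r • q.2)

/-- The compact symplectic group `Sp(m)`: the quaternionic `m × m` matrices `𝐚` with
`𝐚* 𝐚 = 𝐚 𝐚* = 1`. -/
abbrev Sp (m : ℕ) : Submonoid (Matrix (Fin m) (Fin m) ℍ[ℝ]) :=
  unitary (Matrix (Fin m) (Fin m) ℍ[ℝ])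

/-! ### Regular functions -/

/-- The Cauchy-Fueter operator `∂_{x₁} + 𝐢 ∂_{x₂} + 𝐣 ∂_{x₃} + 𝐤 ∂_{x₄}` applied to `F` at `q`,
in the quaternionic variable that the embedding `ι` of `ℍ` inserts into `ℍⁿ`. -/
def cauchyFueter {n : ℕ} (ι : ℍ[ℝ] → QSpace n) (F : QSpace n → ℍ[ℝ]) (q : QSpace n) : ℍ[ℝ] :=
  fderiv ℝ F q (ι (quat 1 0 0 0))
    + quat 0 1 0 0 * fderiv ℝ F q (ι (quat 0 1 0 0))
    + quat 0 0 1 0 * fderiv ℝ F q (ι (quat 0 0 1 0))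
    + quat 0 0 0 1 * fderiv ℝ F q (ι (quat 0 0 0 1))

/-- (Left) regular functions on a set `D` (open in the applications): `C¹` solutions of the
Cauchy-Fueter equations in all `n` quaternionic variables. -/
def IsRegularOn {n : ℕ} (F : QSpace n → ℍ[ℝ]) (D : Set (QSpace n)) : Prop :=
  ContDiffOn ℝ 1 F D ∧ ∀ q ∈ D,
    cauchyFueter (fun x => (x, 0)) F q = 0 ∧
      ∀ k, cauchyFueter (fun x => (0, Pi.single k x)) F q = 0

/-! ### The measure on the boundary, and the Hardy space -/

/-- The inverse of the projection `π : ∂U_n → Im ℍ × ℍⁿ⁻¹`, where `Im ℍ` is `ℝ³`. -/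
def bdryParam (n : ℕ) (x : (Fin 3 → ℝ) × (Fin (n - 1) → ℍ[ℝ])) : QSpace n :=
  (quat (sqNorm x.2) (x.1 0) (x.1 1) (x.1 2), x.2)

theorem bdryParam_mem (n : ℕ) (x : (Fin 3 → ℝ) × (Fin (n - 1) → ℍ[ℝ])) :
    bdryParam n x ∈ bdry n := rfl

theorem continuous_bdryParam (n : ℕ) : Continuous (bdryParam n) := by
  refine Continuous.prodMk ?_ continuous_snd
  have h : (fun x : (Fin 3 → ℝ) × (Fin (n - 1) → ℍ[ℝ]) =>
      quat (sqNorm x.2) (x.1 0) (x.1 1) (x.1 2)) = fun x =>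
      Quaternion.linearIsometryEquivTuple.symm
        (WithLp.toLp 2 ![sqNorm x.2, x.1 0, x.1 1, x.1 2]) := by
    funext x
    rfl
  rw [h]
  refine (LinearIsometryEquiv.continuous _).comp
    ((PiLp.continuous_toLp 2 _).comp (continuous_pi fun i => ?_))
  fin_cases i <;> simp [sqNorm] <;> fun_prop

/-- The measure `dβ` on `∂U_n`, as a Borel measure on `ℍⁿ` carried by `∂U_n`: it corresponds
under the projection `π` to the Lebesgue measure of `Im ℍ × ℍⁿ⁻¹`, the Haar measure of the
quaternionic Heisenberg group. -/
def β (n : ℕ) : Measure (QSpace n) :=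
  (volume : Measure ((Fin 3 → ℝ) × (Fin (n - 1) → ℍ[ℝ]))).map (bdryParam n)

/-- The vertical translate `F_ε (q) = F (q + ε 𝐞)`, `𝐞 = (1, 0, …, 0)`. -/
def vert {n : ℕ} (F : QSpace n → ℍ[ℝ]) (ε : ℝ) (q : QSpace n) : ℍ[ℝ] :=
  F (q + ((ε : ℍ[ℝ]), 0))

/-- Membership of (the restriction to `U_n` of) `F` in the Hardy space `H²(U_n)`. -/
def MemHardy (n : ℕ) (F : QSpace n → ℍ[ℝ]) : Prop :=
  IsRegularOn F (upperHalfSpace n) ∧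
    (⨆ ε : ℝ, ⨆ _ : 0 < ε, ∫⁻ q, ‖vert F ε q‖ₑ ^ 2 ∂(β n)) < ∞

/-- `g ∈ L²(∂U_n)` is the boundary value of `F`: `F_ε → g` in `L²(∂U_n)` as `ε → 0+`. -/
def IsBdryValue (n : ℕ) (F g : QSpace n → ℍ[ℝ]) : Prop :=
  MemLp g 2 (β n) ∧
    Tendsto (fun ε : ℝ => eLpNorm (fun q => vert F ε q - g q) 2 (β n)) (𝓝[>] 0) (𝓝 0)

open Classical in
/-- The boundary value `F^b`, determined up to `β`-null sets (and `0` where there is none). -/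
def bdryValue (n : ℕ) (F : QSpace n → ℍ[ℝ]) : QSpace n → ℍ[ℝ] :=
  if h : ∃ g, IsBdryValue n F g then h.choose else 0

/-! ### The Cauchy-Szegő kernel -/

/-- The conditions that define the Cauchy-Szegő kernel on `U_n × U_n`. -/
structure IsCauchySzegoKernel (n : ℕ) (S : QSpace n → QSpace n → ℍ[ℝ]) : Prop where
  /-- `S(·, p)` belongs to the Hardy space. -/
  memHardy : ∀ p ∈ upperHalfSpace n, MemHardy n (fun q => S q p)
  /-- `S(q, p)` is the conjugate of `S(p, q)`. -/
  symm : ∀ q ∈ upperHalfSpace n, ∀ p ∈ upperHalfSpace n, S q p = star (S p q)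
  /-- `F(q) = ∫ S_b(q, Q) F^b(Q) dβ(Q)`, with `S_b` the boundary value in the second variable. -/
  reproducing : ∀ F, MemHardy n F → ∀ q ∈ upperHalfSpace n,
    F q = ∫ Q, bdryValue n (fun p => S q p) Q * bdryValue n F Q ∂(β n)

open Classical in
/-- The Cauchy-Szegő kernel: the function with the properties above.  These determine it on
`U_n × U_n`; the values elsewhere mean nothing. -/
def cauchySzegoKernel (n : ℕ) : QSpace n → QSpace n → ℍ[ℝ] :=
  if h : ∃ S, IsCauchySzegoKernel n S then h.choose else 0

end

end QSiegel

/-! The conditions defining the kernel determine it on the half space: expanding `S(·, q)` by the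
kernel `T` and `T(·, p)` by the kernel `S` gives conjugate integrals (`IsCauchySzegoKernel.unique`).
Hence it suffices that each transformed function is again a Cauchy-Szegő kernel.

This is proved once, for an affine bijection `φ` that preserves the half space, scales `β` by `κ`,
rescales vertical translations, and for which `u F(φ(·))` is regular whenever `F` is (`IsSymmetry`).
If the inverse of `φ` has the same property with `u⁻¹`, and `|u| = 1`, then `κ⁻¹ u S(φ q, φ p)
conj(u)` is a kernel (`IsCauchySzegoKernel.transform`): the reproducing formula is applied to `u⁻¹
F(φ⁻¹(·))` and the integral is pulled back by `φ`.

For the four families, regularity reduces to two identities for the Cauchy-Fueter operator `D` on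
linear maps: `D(l(a·)) = conj(a) D l` and `D(a l(·a)) = |a|² D l`. The second one forces the factor
`σ` in the third claim. Translations act on the boundary parameters by shears and both rotations by
Euclidean isometries, so `κ = 1`; dilations have homogeneous dimension `2·3 + 4(n-1) = 4n+2`.

Neither the existence of the kernel nor that of boundary values is needed: the default value `0`
satisfies the same transformation rules. -/

namespace QSiegel

/-! ### Regularity -/

/-- The Cauchy-Fueter equation for a real linear map `ℍ → ℍ`. -/
def IsFueter (l : ℍ[ℝ] →ₗ[ℝ] ℍ[ℝ]) : Prop :=
  l (quat 1 0 0 0) + quat 0 1 0 0 * l (quat 0 1 0 0) + quat 0 0 1 0 * l (quat 0 0 1 0)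
    + quat 0 0 0 1 * l (quat 0 0 0 1) = 0

theorem quat_eq_sum (x : ℍ[ℝ]) : x = x.re • quat 1 0 0 0 + x.imI • quat 0 1 0 0
    + x.imJ • quat 0 0 1 0 + x.imK • quat 0 0 0 1 := by
  ext <;> simp

theorem linearMap_apply_eq (l : ℍ[ℝ] →ₗ[ℝ] ℍ[ℝ]) (x : ℍ[ℝ]) :
    l x = x.re • l (quat 1 0 0 0) + x.imI • l (quat 0 1 0 0)
      + x.imJ • l (quat 0 0 1 0) + x.imK • l (quat 0 0 0 1) := by
  conv_lhs => rw [quat_eq_sum x]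
  simp only [map_add, map_smul]

/-- The adjoint of left multiplication by `a` is left multiplication by `conj(a)`, so `∑ eᵢ l(a eᵢ)
= ∑ conj(a) eⱼ l(eⱼ)` over the standard basis. -/
theorem IsFueter.comp_mulLeft {l : ℍ[ℝ] →ₗ[ℝ] ℍ[ℝ]} (hl : IsFueter l) (a : ℍ[ℝ]) :
    IsFueter (l ∘ₗ LinearMap.mulLeft ℝ a) := by
  unfold IsFueter at hl ⊢
  have h : star a * (l (quat 1 0 0 0) + quat 0 1 0 0 * l (quat 0 1 0 0)
    + quat 0 0 1 0 * l (quat 0 0 1 0) + quat 0 0 0 1 * l (quat 0 0 0 1)) = 0 := by simp [hl]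
  rw [← h]
  simp only [LinearMap.comp_apply, LinearMap.mulLeft_apply]
  rw [linearMap_apply_eq l (a * quat 1 0 0 0), linearMap_apply_eq l (a * quat 0 1 0 0),
    linearMap_apply_eq l (a * quat 0 0 1 0), linearMap_apply_eq l (a * quat 0 0 0 1)]
  ext <;> simp <;> ring

/-- Moving right multiplication to its adjoint gives `∑ eᵢ a l(eᵢ a) = ∑ eⱼ conj(a) a l(eⱼ)`; the
left factor `a` is what makes the scalar `|a|²` appear. -/
theorem IsFueter.mul_comp_mulRight {l : ℍ[ℝ] →ₗ[ℝ] ℍ[ℝ]} (hl : IsFueter l) (a : ℍ[ℝ]) :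
    IsFueter (LinearMap.mulLeft ℝ a ∘ₗ l ∘ₗ LinearMap.mulRight ℝ a) := by
  unfold IsFueter at hl ⊢
  have h : (a.re ^ 2 + a.imI ^ 2 + a.imJ ^ 2 + a.imK ^ 2) •
    (l (quat 1 0 0 0) + quat 0 1 0 0 * l (quat 0 1 0 0)
    + quat 0 0 1 0 * l (quat 0 0 1 0) + quat 0 0 0 1 * l (quat 0 0 0 1)) = 0 := by simp [hl]
  rw [← h]
  simp only [LinearMap.comp_apply, LinearMap.mulLeft_apply, LinearMap.mulRight_apply]
  rw [linearMap_apply_eq l (quat 1 0 0 0 * a), linearMap_apply_eq l (quat 0 1 0 0 * a),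
    linearMap_apply_eq l (quat 0 0 1 0 * a), linearMap_apply_eq l (quat 0 0 0 1 * a)]
  ext <;> simp <;> ring

theorem IsFueter.add {l m : ℍ[ℝ] →ₗ[ℝ] ℍ[ℝ]} (hl : IsFueter l) (hm : IsFueter m) :
    IsFueter (l + m) := by
  unfold IsFueter at *
  rw [← add_zero (0 : ℍ[ℝ])]
  nth_rewrite 1 [← hl]
  rw [← hm]
  simp only [LinearMap.add_apply, mul_add]
  abel

theorem isFueter_zero : IsFueter 0 := by simp [IsFueter]

theorem IsFueter.sum {ι : Type*} {l : ι → ℍ[ℝ] →ₗ[ℝ] ℍ[ℝ]} (s : Finset ι)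
    (hl : ∀ i ∈ s, IsFueter (l i)) : IsFueter (∑ i ∈ s, l i) :=
  Finset.sum_induction _ IsFueter (fun _ _ => IsFueter.add) isFueter_zero hl

theorem IsFueter.smul {l : ℍ[ℝ] →ₗ[ℝ] ℍ[ℝ]} (hl : IsFueter l) (c : ℝ) : IsFueter (c • l) := by
  unfold IsFueter at *
  simp only [LinearMap.smul_apply, mul_smul_comm, ← smul_add, hl, smul_zero]

theorem IsFueter.mulRight_comp {l : ℍ[ℝ] →ₗ[ℝ] ℍ[ℝ]} (hl : IsFueter l) (v : ℍ[ℝ]) :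
    IsFueter (LinearMap.mulRight ℝ v ∘ₗ l) := by
  unfold IsFueter at *
  simp only [LinearMap.comp_apply, LinearMap.mulRight_apply, ← mul_assoc, ← add_mul, hl, zero_mul]

/-- The inclusion of the first quaternionic coordinate. -/
noncomputable def inclFst (n : ℕ) : ℍ[ℝ] →ₗ[ℝ] QSpace n := LinearMap.inl ℝ _ _

/-- The inclusion of one of the last `n - 1` quaternionic coordinates. -/
noncomputable def inclSnd (n : ℕ) (k : Fin (n - 1)) : ℍ[ℝ] →ₗ[ℝ] QSpace n :=
  LinearMap.inr ℝ _ _ ∘ₗ LinearMap.single ℝ (fun _ => ℍ[ℝ]) k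

theorem inclFst_apply (n : ℕ) (x : ℍ[ℝ]) : inclFst n x = (x, 0) := rfl

theorem inclSnd_apply (n : ℕ) (k : Fin (n - 1)) (x : ℍ[ℝ]) :
    inclSnd n k x = (0, Pi.single k x) := rfl

/-- The Cauchy-Fueter equations in all variables for a real linear map `ℍⁿ → ℍ`. -/
def IsFueterN {n : ℕ} (L : QSpace n →ₗ[ℝ] ℍ[ℝ]) : Prop :=
  IsFueter (L ∘ₗ inclFst n) ∧ ∀ k, IsFueter (L ∘ₗ inclSnd n k)

/-- The equations are of first order, so under affine maps regularity becomes linear algebra on the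
derivative at each point. -/
theorem isRegularOn_iff {n : ℕ} {F : QSpace n → ℍ[ℝ]} {D : Set (QSpace n)} :
    IsRegularOn F D ↔
      ContDiffOn ℝ 1 F D ∧ ∀ q ∈ D, IsFueterN (fderiv ℝ F q : QSpace n →ₗ[ℝ] ℍ[ℝ]) :=
  Iff.rfl

/-! ### The domain and its boundary -/

theorem continuous_sqNorm {m : ℕ} : Continuous (sqNorm : (Fin m → ℍ[ℝ]) → ℝ) := by
  unfold sqNorm
  fun_prop

theorem isOpen_upperHalfSpace (n : ℕ) : IsOpen (upperHalfSpace n) :=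
  isOpen_lt (continuous_sqNorm.comp continuous_snd)
    (Quaternion.continuous_re.comp continuous_fst)

theorem isClosed_bdry (n : ℕ) : IsClosed (bdry n) :=
  isClosed_eq (Quaternion.continuous_re.comp continuous_fst)
    (continuous_sqNorm.comp continuous_snd)

theorem add_vert_mem {n : ℕ} {q : QSpace n} (hq : q ∈ bdry n) {ε : ℝ} (hε : 0 < ε) :
    q + ((ε : ℍ[ℝ]), 0) ∈ upperHalfSpace n := by
  have h : q.1.re = sqNorm q.2 := hq
  simp [upperHalfSpace, h, hε]

theorem ae_mem_bdry (n : ℕ) : ∀ᵐ q ∂(β n), q ∈ bdry n := by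
  refine (ae_map_iff (continuous_bdryParam n).aemeasurable (isClosed_bdry n).measurableSet).2 ?_
  exact Eventually.of_forall (bdryParam_mem n)

theorem vert_ae_eq {n : ℕ} {F G : QSpace n → ℍ[ℝ]} (h : Set.EqOn F G (upperHalfSpace n)) {ε : ℝ}
    (hε : 0 < ε) : vert F ε =ᵐ[β n] vert G ε := by
  filter_upwards [ae_mem_bdry n] with q hq using h (add_vert_mem hq hε)

theorem aestronglyMeasurable_vert {n : ℕ} {F : QSpace n → ℍ[ℝ]}
    (hF : ContinuousOn F (upperHalfSpace n)) {ε : ℝ} (hε : 0 < ε) :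
    AEStronglyMeasurable (vert F ε) (β n) := by
  -- `F` is controlled only inside the half space; restricting `β` to its carrier makes continuity
  -- on the boundary sufficient.
  rw [← Measure.restrict_eq_self_of_ae_mem (ae_mem_bdry n)]
  refine ContinuousOn.aestronglyMeasurable ?_ (isClosed_bdry n).measurableSet
  exact hF.comp (by fun_prop) fun q hq => add_vert_mem hq hε

/-! ### Boundary values -/

theorem IsBdryValue.ae_eq {n : ℕ} {F g h : QSpace n → ℍ[ℝ]}
    (hF : ContinuousOn F (upperHalfSpace n)) (hg : IsBdryValue n F g) (hh : IsBdryValue n F h) :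
    g =ᵐ[β n] h := by
  have key : eLpNorm (g - h) 2 (β n) ≤ 0 := by
    have hlim := hg.2.add hh.2
    rw [add_zero] at hlim
    refine ge_of_tendsto hlim ?_
    filter_upwards [self_mem_nhdsWithin] with ε hε
    have hm := aestronglyMeasurable_vert hF hε
    have h1 : g - h = (fun q => vert F ε q - h q) - (fun q => vert F ε q - g q) := by
      ext1 q; simp
    rw [h1, add_comm]
    exact eLpNorm_sub_le (hm.sub hh.1.1) (hm.sub hg.1.1) (by norm_num)
  have h0 := (eLpNorm_eq_zero_iff (hg.1.1.sub hh.1.1) (by norm_num)).1 (le_antisymm key bot_le)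
  filter_upwards [h0] with q hq
  exact sub_eq_zero.1 hq

theorem bdryValue_spec {n : ℕ} {F : QSpace n → ℍ[ℝ]} (h : ∃ g, IsBdryValue n F g) :
    IsBdryValue n F (bdryValue n F) := by
  rw [bdryValue, dif_pos h]
  exact h.choose_spec

theorem IsBdryValue.bdryValue_ae_eq {n : ℕ} {F g : QSpace n → ℍ[ℝ]}
    (hF : ContinuousOn F (upperHalfSpace n)) (hg : IsBdryValue n F g) :
    bdryValue n F =ᵐ[β n] g :=
  (bdryValue_spec ⟨g, hg⟩).ae_eq hF hg

theorem IsBdryValue.congr {n : ℕ} {F G g : QSpace n → ℍ[ℝ]} (hg : IsBdryValue n F g)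
    (h : Set.EqOn F G (upperHalfSpace n)) : IsBdryValue n G g := by
  refine ⟨hg.1, hg.2.congr' ?_⟩
  filter_upwards [self_mem_nhdsWithin] with ε hε
  refine eLpNorm_congr_ae ?_
  filter_upwards [vert_ae_eq h hε] with q hq
  rw [hq]

/-- If boundary values of `F` and `G` are exchanged by `Φ`, then so are the chosen ones. -/
theorem bdryValue_ae_eq_of_transform {n : ℕ} {F G : QSpace n → ℍ[ℝ]}
    (hG : ContinuousOn G (upperHalfSpace n)) (Φ : (QSpace n → ℍ[ℝ]) → QSpace n → ℍ[ℝ])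
    (h0 : Φ 0 = 0) (hΦ : ∀ g, IsBdryValue n F g → IsBdryValue n G (Φ g))
    (hex : (∃ g, IsBdryValue n G g) → ∃ g, IsBdryValue n F g) :
    bdryValue n G =ᵐ[β n] Φ (bdryValue n F) := by
  by_cases h : ∃ g, IsBdryValue n F g
  · exact (hΦ _ (bdryValue_spec h)).bdryValue_ae_eq hG
  -- Without boundary values both choices are the default `0`, which `Φ` fixes.
  · rw [bdryValue, dif_neg (mt hex h), bdryValue, dif_neg h, h0]

theorem bdryValue_congr {n : ℕ} {F G : QSpace n → ℍ[ℝ]} (hG : ContinuousOn G (upperHalfSpace n))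
    (h : Set.EqOn F G (upperHalfSpace n)) : bdryValue n G =ᵐ[β n] bdryValue n F :=
  bdryValue_ae_eq_of_transform hG id rfl (fun _ hg => hg.congr h)
    fun ⟨g, hg⟩ => ⟨g, hg.congr h.symm⟩

theorem IsBdryValue.star {n : ℕ} {F g : QSpace n → ℍ[ℝ]} (hg : IsBdryValue n F g) :
    IsBdryValue n (star F) (star g) := by
  refine ⟨hg.1.star, hg.2.congr fun ε => ?_⟩
  refine eLpNorm_congr_norm_ae (Eventually.of_forall fun q => ?_)
  simp [vert, ← star_sub]

theorem bdryValue_star {n : ℕ} {F : QSpace n → ℍ[ℝ]} (hF : ContinuousOn F (upperHalfSpace n)) :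
    bdryValue n (star F) =ᵐ[β n] star (bdryValue n F) :=
  bdryValue_ae_eq_of_transform hF.star star (star_zero _) (fun _ hg => hg.star)
    fun ⟨g, hg⟩ => ⟨star g, star_star F ▸ hg.star⟩

theorem MemHardy.continuousOn {n : ℕ} {F : QSpace n → ℍ[ℝ]} (hF : MemHardy n F) :
    ContinuousOn F (upperHalfSpace n) := hF.1.1.continuousOn

/-! ### Uniqueness of the kernel -/

namespace IsCauchySzegoKernel

variable {n : ℕ} {S T : QSpace n → QSpace n → ℍ[ℝ]}

theorem eqOn_star (hS : IsCauchySzegoKernel n S) {q : QSpace n} (hq : q ∈ upperHalfSpace n) :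
    Set.EqOn (star fun p => S p q) (S q) (upperHalfSpace n) :=
  fun p hp => (hS.symm q hq p hp).symm

theorem continuousOn (hS : IsCauchySzegoKernel n S) {q : QSpace n}
    (hq : q ∈ upperHalfSpace n) : ContinuousOn (S q) (upperHalfSpace n) :=
  (hS.memHardy q hq).continuousOn.star.congr (hS.eqOn_star hq).symm

theorem bdryValue_ae_eq_star (hS : IsCauchySzegoKernel n S) {q : QSpace n}
    (hq : q ∈ upperHalfSpace n) :
    bdryValue n (S q) =ᵐ[β n] star (bdryValue n fun p => S p q) :=
  (bdryValue_congr (hS.continuousOn hq) (hS.eqOn_star hq)).trans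
    (bdryValue_star (hS.memHardy q hq).continuousOn)

/-- The Cauchy-Szegő kernel is unique. -/
theorem unique (hS : IsCauchySzegoKernel n S) (hT : IsCauchySzegoKernel n T) {q p : QSpace n}
    (hq : q ∈ upperHalfSpace n) (hp : p ∈ upperHalfSpace n) : S q p = T q p := by
  -- Each section is reproduced by the other kernel; conjugation reverses the product and, by
  -- Hermitian symmetry, exchanges the two integrands.
  rw [hS.symm q hq p hp, hT.reproducing _ (hS.memHardy q hq) p hp,
    hS.reproducing _ (hT.memHardy p hp) q hq]
  have : StarModule ℝ ℍ[ℝ] := ⟨fun r x => by simp⟩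
  change starL' ℝ (∫ Q, _ ∂(β n)) = _
  -- A continuous linear equivalence commutes with the integral without any integrability
  -- assumption.
  rw [← (starL' ℝ).integral_comp_comm]
  refine integral_congr_ae ?_
  filter_upwards [hS.bdryValue_ae_eq_star hq, hT.bdryValue_ae_eq_star hp] with Q h1 h2
  change star (bdryValue n (T p) Q * _) = bdryValue n (S q) Q * _
  rw [h1, h2, star_mul]
  simp

end IsCauchySzegoKernel

/-! ### Symmetries of the Siegel half space -/

/-- An affine self-map of `ℍⁿ` that maps the half space into itself, commutes with vertical
translations up to the scale `s`, multiplies `β` by `κ`, and preserves regularity up to the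
left factor `u`. -/
structure IsSymmetry {n : ℕ} (φ : QSpace n → QSpace n) (s κ : ℝ) (u : ℍ[ℝ]) : Prop where
  affine : ∃ A : QSpace n →ₗ[ℝ] QSpace n, (∀ q, φ q = A q + φ 0) ∧
    ∀ L : QSpace n →ₗ[ℝ] ℍ[ℝ], IsFueterN L → IsFueterN (LinearMap.mulLeft ℝ u ∘ₗ L ∘ₗ A)
  mapsTo : Set.MapsTo φ (upperHalfSpace n) (upperHalfSpace n)
  scale_pos : 0 < s
  vert : ∀ q (ε : ℝ), φ (q + ((ε : ℍ[ℝ]), 0)) = φ q + (((s * ε : ℝ) : ℍ[ℝ]), 0)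
  map_β : (β n).map φ = ENNReal.ofReal κ • β n

/-- The function `u F(φ(·)) v`. -/
noncomputable def pullback {n : ℕ} (φ : QSpace n → QSpace n) (u v : ℍ[ℝ]) (F : QSpace n → ℍ[ℝ]) :
    QSpace n → ℍ[ℝ] := fun q => u * F (φ q) * v

namespace IsSymmetry

variable {n : ℕ} {φ ψ : QSpace n → QSpace n} {s κ s' κ' : ℝ} {u u' : ℍ[ℝ]} {F : QSpace n → ℍ[ℝ]}

theorem contDiff (h : IsSymmetry φ s κ u) : ContDiff ℝ 1 φ := by
  obtain ⟨A, hA, -⟩ := h.affine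
  rw [funext hA]
  exact (LinearMap.toContinuousLinearMap A).contDiff.add contDiff_const

theorem isRegularOn (h : IsSymmetry φ s κ u) (v : ℍ[ℝ])
    (hF : IsRegularOn F (upperHalfSpace n)) :
    IsRegularOn (pullback φ u v F) (upperHalfSpace n) := by
  rw [isRegularOn_iff] at hF ⊢
  refine ⟨(contDiffOn_const.mul (hF.1.comp h.contDiff.contDiffOn h.mapsTo)).mul
    contDiffOn_const, fun q hq => ?_⟩
  obtain ⟨A, hA, hL⟩ := h.affine
  have hφ : HasFDerivAt φ (LinearMap.toContinuousLinearMap A) q := by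
    rw [funext hA]
    exact (LinearMap.toContinuousLinearMap A).hasFDerivAt.add_const _
  have hd : HasFDerivAt F (fderiv ℝ F (φ q)) (φ q) :=
    ((hF.1.differentiableOn (by norm_num)).differentiableAt
      ((isOpen_upperHalfSpace n).mem_nhds (h.mapsTo hq))).hasFDerivAt
  have hc := ((hd.comp q hφ).const_mul u).mul_const' v
  have he : (fderiv ℝ (pullback φ u v F) q : QSpace n →ₗ[ℝ] ℍ[ℝ]) =
      LinearMap.mulRight ℝ v ∘ₗ LinearMap.mulLeft ℝ u ∘ₗ
        (fderiv ℝ F (φ q) : QSpace n →ₗ[ℝ] ℍ[ℝ]) ∘ₗ A := by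
    rw [HasFDerivAt.fderiv (f := pullback φ u v F) hc]
    ext1 <;> rfl
  rw [he]
  have h1 := hL _ (hF.2 _ (h.mapsTo hq))
  exact ⟨h1.1.mulRight_comp v, fun k => (h1.2 k).mulRight_comp v⟩

theorem measurableEmbedding (h : IsSymmetry φ s κ u) (h' : IsSymmetry ψ s' κ' u')
    (hl : Function.LeftInverse ψ φ) (hr : Function.RightInverse ψ φ) : MeasurableEmbedding φ :=
  (Homeomorph.mk ⟨φ, ψ, hl, hr⟩ h.contDiff.continuous
    h'.contDiff.continuous).measurableEmbedding

theorem vert_pullback (h : IsSymmetry φ s κ u) (w v : ℍ[ℝ]) (ε : ℝ) :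
    QSiegel.vert (pullback φ w v F) ε = pullback φ w v (QSiegel.vert F (s * ε)) := by
  funext q
  simp only [QSiegel.vert, pullback, h.vert]

theorem memHardy (h : IsSymmetry φ s κ u) (he : MeasurableEmbedding φ) (v : ℍ[ℝ])
    (hF : MemHardy n F) : MemHardy n (pullback φ u v F) := by
  refine ⟨h.isRegularOn v hF.1, ?_⟩
  set C := ⨆ ε : ℝ, ⨆ _ : 0 < ε, ∫⁻ q, ‖QSiegel.vert F ε q‖ₑ ^ 2 ∂(β n)
  have hC : C < ∞ := hF.2
  refine lt_of_le_of_lt (b := ‖u‖ₑ ^ 2 * ‖v‖ₑ ^ 2 * (ENNReal.ofReal κ * C))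
    (iSup₂_le fun ε hε => ?_) ?_
  · rw [h.vert_pullback]
    have h1 : ∀ q, ‖pullback φ u v (QSiegel.vert F (s * ε)) q‖ₑ ^ 2 =
        ‖u‖ₑ ^ 2 * ‖v‖ₑ ^ 2 * ‖QSiegel.vert F (s * ε) (φ q)‖ₑ ^ 2 := fun q => by
      simp only [pullback, enorm_mul]
      ring
    simp only [h1]
    rw [lintegral_const_mul' _ _ (by finiteness),
      ← he.lintegral_map (fun q => ‖QSiegel.vert F (s * ε) q‖ₑ ^ 2), h.map_β,
      lintegral_smul_measure, smul_eq_mul]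
    gcongr
    exact le_iSup₂ (f := fun (ε : ℝ) (_ : 0 < ε) => ∫⁻ q, ‖QSiegel.vert F ε q‖ₑ ^ 2 ∂(β n))
      (s * ε) (mul_pos h.scale_pos hε)
  · finiteness

theorem eLpNorm_pullback (h : IsSymmetry φ s κ u) (he : MeasurableEmbedding φ) (w v : ℍ[ℝ])
    (g : QSpace n → ℍ[ℝ]) : eLpNorm (pullback φ w v g) 2 (β n) =
      ‖w‖ₑ * ‖v‖ₑ * (ENNReal.ofReal κ ^ (1 / 2 : ℝ) * eLpNorm g 2 (β n)) := by
  have h1 : eLpNorm (pullback φ w v g) 2 (β n) = eLpNorm ((‖w‖ * ‖v‖) • (g ∘ φ)) 2 (β n) := by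
    refine eLpNorm_congr_norm_ae (Eventually.of_forall fun q => ?_)
    simp [pullback, norm_smul]
    ring
  rw [h1, eLpNorm_const_smul, ← he.eLpNorm_map_measure, h.map_β,
    eLpNorm_smul_measure_of_ne_top (by norm_num)]
  simp [enorm_mul]

/-- The factor `w` may differ from `u`: boundary values involve no regularity. This matters for
kernels as functions of their second variable. -/
theorem isBdryValue (h : IsSymmetry φ s κ u) (he : MeasurableEmbedding φ) (w v : ℍ[ℝ])
    {g : QSpace n → ℍ[ℝ]} (hg : IsBdryValue n F g) :
    IsBdryValue n (pullback φ w v F) (pullback φ w v g) := by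
  refine ⟨⟨?_, ?_⟩, ?_⟩
  · have h1 : AEStronglyMeasurable (g ∘ φ) (β n) := by
      refine AEStronglyMeasurable.comp_measurable ?_ he.measurable
      rw [h.map_β]
      exact hg.1.1.smul_measure _
    exact (aestronglyMeasurable_const.mul h1).mul aestronglyMeasurable_const
  · rw [h.eLpNorm_pullback he]
    have := hg.1.2
    finiteness
  · have h1 : ∀ ε : ℝ, (fun q => QSiegel.vert (pullback φ w v F) ε q - pullback φ w v g q) =
        pullback φ w v (fun q => QSiegel.vert F (s * ε) q - g q) := fun ε => by
      rw [h.vert_pullback]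
      funext q
      simp only [pullback, mul_sub, sub_mul]
    simp only [h1, h.eLpNorm_pullback he]
    have ht : Tendsto (fun ε : ℝ => s * ε) (𝓝[>] 0) (𝓝[>] 0) := by
      refine tendsto_nhdsWithin_iff.2 ⟨?_, ?_⟩
      · have : Tendsto (fun ε : ℝ => s * ε) (𝓝 0) (𝓝 (s * 0)) := tendsto_id.const_mul s
        rw [mul_zero] at this
        exact this.mono_left nhdsWithin_le_nhds
      · filter_upwards [self_mem_nhdsWithin] with ε hε using mul_pos h.scale_pos hε
    have h2 := ENNReal.Tendsto.const_mul (a := ‖w‖ₑ * ‖v‖ₑ * ENNReal.ofReal κ ^ (1 / 2 : ℝ))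
      (hg.2.comp ht) (Or.inr (by finiteness))
    simpa [mul_assoc] using h2

theorem bdryValue_pullback (h : IsSymmetry φ s κ u) (h' : IsSymmetry ψ s' κ' u')
    (hl : Function.LeftInverse ψ φ) (hr : Function.RightInverse ψ φ) {w v : ℍ[ℝ]} (hw : w ≠ 0)
    (hv : v ≠ 0) (hF : ContinuousOn F (upperHalfSpace n)) :
    bdryValue n (pullback φ w v F) =ᵐ[β n] pullback φ w v (bdryValue n F) := by
  refine bdryValue_ae_eq_of_transform ?_ (pullback φ w v) ?_
    (fun g hg => h.isBdryValue (h.measurableEmbedding h' hl hr) w v hg) ?_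
  · exact (continuousOn_const.mul (hF.comp h.contDiff.continuous.continuousOn h.mapsTo)).mul
      continuousOn_const
  · funext q
    simp [pullback]
  · rintro ⟨g, hg⟩
    -- Invertible factors allow the pullback to be undone, so boundary values exist on both sides or
    -- on neither.
    refine ⟨pullback ψ w⁻¹ v⁻¹ g, ?_⟩
    have h1 := h'.isBdryValue (h'.measurableEmbedding h hr hl) w⁻¹ v⁻¹ hg
    have h2 : pullback ψ w⁻¹ v⁻¹ (pullback φ w v F) = F := by
      funext q
      simp only [pullback, hr q]
      rw [mul_assoc, mul_assoc, mul_inv_cancel₀ hv, mul_one, inv_mul_cancel_left₀ hw]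
    rwa [h2] at h1

end IsSymmetry

theorem star_eq_inv_of_norm_eq_one {u : ℍ[ℝ]} (hu : ‖u‖ = 1) : star u = u⁻¹ := by
  have h : u * star u = 1 := by
    rw [Quaternion.self_mul_star, Quaternion.normSq_eq_norm_mul_self, hu]
    simp
  exact eq_inv_of_mul_eq_one_right h

theorem integral_quaternion_const_mul {α : Type*} [MeasurableSpace α] (μ : Measure α) {u : ℍ[ℝ]}
    (hu : u ≠ 0) (f : α → ℍ[ℝ]) : ∫ x, u * f x ∂μ = u * ∫ x, f x ∂μ :=
  (ContinuousLinearEquiv.smulLeft (R₁ := ℝ) (M₁ := ℍ[ℝ]) (Units.mk0 u hu)).integral_comp_comm f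

theorem IsSymmetry.integral_comp {n : ℕ} {φ : QSpace n → QSpace n} {s κ : ℝ} {u : ℍ[ℝ]}
    (h : IsSymmetry φ s κ u) (he : MeasurableEmbedding φ) (hκ : 0 < κ) (f : QSpace n → ℍ[ℝ]) :
    ∫ Q, f Q ∂(β n) = κ⁻¹ • ∫ Q, f (φ Q) ∂(β n) := by
  rw [← he.integral_map, h.map_β, integral_smul_measure, ENNReal.toReal_ofReal hκ.le,
    inv_smul_smul₀ hκ.ne']

/-! ### Transformation of the kernel under a symmetry -/

section Transform

variable {n : ℕ} {S : QSpace n → QSpace n → ℍ[ℝ]} {φ ψ : QSpace n → QSpace n} {s κ s' κ' : ℝ}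
  {u : ℍ[ℝ]}

theorem IsCauchySzegoKernel.symm_transform (hS : IsCauchySzegoKernel n S)
    (hφ : Set.MapsTo φ (upperHalfSpace n) (upperHalfSpace n)) (u : ℍ[ℝ]) (c : ℝ)
    {q p : QSpace n} (hq : q ∈ upperHalfSpace n) (hp : p ∈ upperHalfSpace n) :
    u * S (φ q) (φ p) * (c * star u) = star (u * S (φ p) (φ q) * (c * star u)) := by
  rw [hS.symm _ (hφ hq) _ (hφ hp)]
  simp only [Quaternion.coe_mul_eq_smul, mul_smul_comm, star_mul, star_star, Quaternion.star_smul,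
    mul_assoc]

/-- With `G = u⁻¹ F(ψ(·))`, which is again in the Hardy space, `F(q) = u G(φ q)`. The change of
variables produces `κ⁻¹`, and the `u⁻¹ = conj(u)` in the boundary value of `G` moves to the right of
the kernel. -/
theorem IsCauchySzegoKernel.reproducing_transform (hS : IsCauchySzegoKernel n S)
    (h : IsSymmetry φ s κ u) (h' : IsSymmetry ψ s' κ' u⁻¹) (hl : Function.LeftInverse ψ φ)
    (hr : Function.RightInverse ψ φ) (hκ : 0 < κ) (hu : ‖u‖ = 1) {F : QSpace n → ℍ[ℝ]}
    (hF : MemHardy n F) {q : QSpace n} (hq : q ∈ upperHalfSpace n) :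
    F q = ∫ Q, bdryValue n (pullback φ u ((κ⁻¹ : ℝ) * star u) (S (φ q))) Q
      * bdryValue n F Q ∂(β n) := by
  have hu0 : u ≠ 0 := norm_ne_zero_iff.1 (by simp [hu])
  have hsu : star u = u⁻¹ := star_eq_inv_of_norm_eq_one hu
  have hv0 : ((κ⁻¹ : ℝ) * star u : ℍ[ℝ]) ≠ 0 := by
    rw [Quaternion.coe_mul_eq_smul, hsu]
    exact smul_ne_zero (inv_ne_zero hκ.ne') (inv_ne_zero hu0)
  have he := h.measurableEmbedding h' hl hr
  have he' := h'.measurableEmbedding h hr hl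
  have hb := h.bdryValue_pullback h' hl hr hu0 hv0 (hS.continuousOn (h.mapsTo hq))
  have hb' := h.bdryValue_pullback h' hl hr hu0 one_ne_zero
    (h'.memHardy he' 1 hF).continuousOn
  have h2 : pullback φ u 1 (pullback ψ u⁻¹ 1 F) = F := by
    funext q
    simp [pullback, hl q, hu0]
  rw [h2] at hb'
  calc F q = u * pullback ψ u⁻¹ 1 F (φ q) := by simp [pullback, hl q, hu0]
    _ = u * (κ⁻¹ • ∫ Q, bdryValue n (S (φ q)) (φ Q) *
          bdryValue n (pullback ψ u⁻¹ 1 F) (φ Q) ∂(β n)) := by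
      rw [hS.reproducing _ (h'.memHardy he' 1 hF) _ (h.mapsTo hq)]
      exact congrArg (u * ·) (h.integral_comp he hκ fun Q =>
        bdryValue n (S (φ q)) Q * bdryValue n (pullback ψ u⁻¹ 1 F) Q)
    _ = _ := by
      rw [← integral_smul, ← integral_quaternion_const_mul _ hu0]
      refine integral_congr_ae ?_
      filter_upwards [hb, hb'] with Q h3 h4
      rw [h3, h4, hsu]
      simp only [pullback, mul_one, Quaternion.coe_mul_eq_smul, mul_smul_comm, smul_mul_assoc,
        mul_assoc, inv_mul_cancel_left₀ hu0]

/-- Symmetries transform the kernel into another kernel. -/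
theorem IsCauchySzegoKernel.transform (hS : IsCauchySzegoKernel n S)
    (h : IsSymmetry φ s κ u) (h' : IsSymmetry ψ s' κ' u⁻¹) (hl : Function.LeftInverse ψ φ)
    (hr : Function.RightInverse ψ φ) (hκ : 0 < κ) (hu : ‖u‖ = 1) :
    IsCauchySzegoKernel n fun q p => u * S (φ q) (φ p) * ((κ⁻¹ : ℝ) * star u) where
  memHardy p hp := by
    have h1 := h.memHardy (h.measurableEmbedding h' hl hr) ((κ⁻¹ : ℝ) * star u)
      (hS.memHardy _ (h.mapsTo hp))
    exact h1
  symm q hq p hp := by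
    have h1 := hS.symm_transform h.mapsTo u κ⁻¹ hq hp
    exact h1
  reproducing F hF q hq := by
    have h1 := hS.reproducing_transform h h' hl hr hκ hu hF hq
    exact h1

theorem cauchySzegoKernel_transform (h : IsSymmetry φ s κ u) (h' : IsSymmetry ψ s' κ' u⁻¹)
    (hl : Function.LeftInverse ψ φ) (hr : Function.RightInverse ψ φ) (hκ : 0 < κ) (hu : ‖u‖ = 1)
    {q Q : QSpace n} (hq : q ∈ upperHalfSpace n) (hQ : Q ∈ upperHalfSpace n) :
    u * cauchySzegoKernel n (φ q) (φ Q) * ((κ⁻¹ : ℝ) * star u) = cauchySzegoKernel n q Q := by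
  by_cases hex : ∃ S, IsCauchySzegoKernel n S
  · have hS : IsCauchySzegoKernel n (cauchySzegoKernel n) := by
      rw [cauchySzegoKernel, dif_pos hex]
      exact hex.choose_spec
    exact (hS.transform h h' hl hr hκ hu).unique hS hq hQ
  -- If there is no kernel, the definition gives `0` and both sides vanish.
  · simp [cauchySzegoKernel, hex]

end Transform

/-! ### Linear algebra of `⟨·, ·⟩` -/

theorem hInner_add_right {m : ℕ} (p q r : Fin m → ℍ[ℝ]) :
    hInner p (q + r) = hInner p q + hInner p r := by
  simp [hInner, mul_add, Finset.sum_add_distrib]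

theorem hInner_neg_left {m : ℕ} (p q : Fin m → ℍ[ℝ]) : hInner (-p) q = -hInner p q := by
  simp [hInner]

theorem hInner_smul_right {m : ℕ} (p q : Fin m → ℍ[ℝ]) (c : ℝ) :
    hInner p (c • q) = c • hInner p q := by
  simp [hInner, Finset.smul_sum]

theorem hInner_single_right {m : ℕ} (p : Fin m → ℍ[ℝ]) (k : Fin m) (x : ℍ[ℝ]) :
    hInner p (Pi.single k x) = star (p k) * x := by
  simp [hInner, Pi.single_apply]

theorem hInner_zero_right {m : ℕ} (p : Fin m → ℍ[ℝ]) : hInner p 0 = 0 := by simp [hInner]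

theorem hInner_self {m : ℕ} (q : Fin m → ℍ[ℝ]) : hInner q q = (sqNorm q : ℝ) := by
  have h : ((sqNorm q : ℝ) : ℍ[ℝ]) = ∑ k, ((‖q k‖ ^ 2 : ℝ) : ℍ[ℝ]) :=
    map_sum (algebraMap ℝ ℍ[ℝ]) (fun k => ‖q k‖ ^ 2) Finset.univ
  rw [h]
  simp only [hInner, Quaternion.star_mul_self, Quaternion.normSq_eq_norm_mul_self, sq]

theorem continuous_hInner {m : ℕ} (p : Fin m → ℍ[ℝ]) : Continuous (hInner p) := by
  unfold hInner
  fun_prop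

theorem norm_sq_quaternion (x : ℍ[ℝ]) :
    ‖x‖ ^ 2 = x.re ^ 2 + x.imI ^ 2 + x.imJ ^ 2 + x.imK ^ 2 := by
  rw [sq, ← Quaternion.normSq_eq_norm_mul_self, Quaternion.normSq_def']

theorem sqNorm_add {m : ℕ} (q p : Fin m → ℍ[ℝ]) :
    sqNorm (q + p) = sqNorm q + sqNorm p + 2 * (hInner p q).re := by
  have h : ∀ x y : ℍ[ℝ], ‖x + y‖ ^ 2 = ‖x‖ ^ 2 + ‖y‖ ^ 2 + 2 * (star y * x).re := fun x y => by
    simp only [norm_sq_quaternion]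
    simp
    ring
  have hre : (hInner p q).re = ∑ k, (star (p k) * q k).re :=
    map_sum (QuaternionAlgebra.reₗ (-1 : ℝ) 0 (-1)) _ _
  simp only [sqNorm, Pi.add_apply, h, hre, Finset.sum_add_distrib, Finset.mul_sum]

theorem sqNorm_smul {m : ℕ} (r : ℝ) (q : Fin m → ℍ[ℝ]) : sqNorm (r • q) = r ^ 2 * sqNorm q := by
  simp [sqNorm, norm_smul, mul_pow, Finset.mul_sum]

theorem sqNorm_mul_right {m : ℕ} (q : Fin m → ℍ[ℝ]) {σ : ℍ[ℝ]} (hσ : ‖σ‖ = 1) :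
    sqNorm (fun k => q k * σ) = sqNorm q := by
  simp [sqNorm, hσ]

theorem hInner_eq_dotProduct {m : ℕ} (p q : Fin m → ℍ[ℝ]) : hInner p q = star p ⬝ᵥ q := rfl

theorem sqNorm_mulVec {m : ℕ} {a : Matrix (Fin m) (Fin m) ℍ[ℝ]} (ha : a ∈ Sp m)
    (q : Fin m → ℍ[ℝ]) : sqNorm (a.mulVec q) = sqNorm q := by
  have h : hInner (a.mulVec q) (a.mulVec q) = hInner q q := by
    rw [hInner_eq_dotProduct, hInner_eq_dotProduct, Matrix.star_mulVec, Matrix.dotProduct_mulVec,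
      Matrix.vecMul_vecMul, ← Matrix.star_eq_conjTranspose, Unitary.star_mul_self_of_mem ha,
      Matrix.vecMul_one]
  rw [hInner_self, hInner_self] at h
  exact Quaternion.coe_injective h

/-! ### The boundary measure under symmetries -/

/-- The parameter space `Im ℍ × ℍⁿ⁻¹` of the boundary. -/
abbrev BdryParam (n : ℕ) : Type := (Fin 3 → ℝ) × (Fin (n - 1) → ℍ[ℝ])

instance isAddHaarMeasure_bdryParam (n : ℕ) : (volume : Measure (BdryParam n)).IsAddHaarMeasure :=
  Measure.prod.instIsAddHaarMeasure _ _

/-- Since `β` is a pushforward of Lebesgue measure, only the action on the boundary parameters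
matters. -/
theorem map_β_of_semiconj {n : ℕ} {φ : QSpace n → QSpace n} {g : BdryParam n → BdryParam n}
    {κ : ℝ} (hφ : Measurable φ) (hg : Measurable g)
    (h : ∀ x, φ (bdryParam n x) = bdryParam n (g x))
    (hm : (volume : Measure (BdryParam n)).map g = ENNReal.ofReal κ • volume) :
    (β n).map φ = ENNReal.ofReal κ • β n := by
  have hb := (continuous_bdryParam n).measurable
  rw [β, Measure.map_map hφ hb, show φ ∘ bdryParam n = bdryParam n ∘ g from funext h,
    ← Measure.map_map hb hg, hm, Measure.map_smul]

/-- The squared Euclidean norm on the parameter space. -/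
noncomputable def paramSqNorm {n : ℕ} (x : BdryParam n) : ℝ := ∑ i, x.1 i ^ 2 + sqNorm x.2

/-- The ambient norm is a supremum norm. This comparison yields injectivity of Euclidean isometries
and boundedness of the Euclidean unit ball. -/
theorem norm_sq_le_paramSqNorm {n : ℕ} (x : BdryParam n) : ‖x‖ ^ 2 ≤ paramSqNorm x := by
  have h0 : 0 ≤ paramSqNorm x := by unfold paramSqNorm sqNorm; positivity
  have h2 : 0 ≤ sqNorm x.2 := by unfold sqNorm; positivity
  have h1 : (0 : ℝ) ≤ ∑ i, x.1 i ^ 2 := by positivity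
  refine (Real.le_sqrt (norm_nonneg _) h0).1 ?_
  refine norm_prod_le_iff.2 ⟨(pi_norm_le_iff_of_nonneg (Real.sqrt_nonneg _)).2 fun i => ?_,
    (pi_norm_le_iff_of_nonneg (Real.sqrt_nonneg _)).2 fun k => ?_⟩
  · refine (Real.le_sqrt (norm_nonneg _) h0).2 ?_
    rw [Real.norm_eq_abs, sq_abs]
    have := Finset.single_le_sum (f := fun i => x.1 i ^ 2) (fun _ _ => sq_nonneg _)
      (Finset.mem_univ i)
    unfold paramSqNorm
    linarith
  · refine (Real.le_sqrt (norm_nonneg _) h0).2 ?_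
    have := Finset.single_le_sum (f := fun k => ‖x.2 k‖ ^ 2) (fun _ _ => sq_nonneg _)
      (Finset.mem_univ k)
    unfold paramSqNorm
    simp only [sqNorm] at this ⊢
    linarith

theorem continuous_paramSqNorm {n : ℕ} : Continuous (paramSqNorm (n := n)) := by
  have := continuous_sqNorm (m := n - 1)
  unfold paramSqNorm
  fun_prop

/-- Linear isometries of the parameter space preserve the Lebesgue measure. -/
theorem map_volume_of_paramSqNorm {n : ℕ} (A : BdryParam n →ₗ[ℝ] BdryParam n)
    (hA : ∀ x, paramSqNorm (A x) = paramSqNorm x) :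
    (volume : Measure (BdryParam n)).map A = volume := by
  have hinj : LinearMap.ker A = ⊥ := by
    refine LinearMap.ker_eq_bot'.2 fun x hx => ?_
    have h1 := norm_sq_le_paramSqNorm x
    rw [← hA, hx] at h1
    have h2 : paramSqNorm (0 : BdryParam n) = 0 := by simp [paramSqNorm, sqNorm]
    rw [h2] at h1
    exact norm_eq_zero.1 (pow_eq_zero_iff two_ne_zero |>.1 (le_antisymm h1 (sq_nonneg _)))
  have hdet : LinearMap.det A ≠ 0 :=
    ((LinearMap.isUnit_iff_isUnit_det A).1 ((LinearMap.isUnit_iff_ker_eq_bot A).2 hinj)).ne_zero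
  have hmap := Measure.map_linearMap_addHaar_eq_smul_addHaar
    (μ := (volume : Measure (BdryParam n))) hdet
  set c := ENNReal.ofReal |(LinearMap.det A)⁻¹|
  -- The map scales volume by `c` and preserves the Euclidean unit ball `B`, whose volume is
  -- positive and finite; hence `c = 1`.
  set B : Set (BdryParam n) := {x | paramSqNorm x < 1}
  have hB : IsOpen B := isOpen_lt continuous_paramSqNorm continuous_const
  have hpre : A ⁻¹' B = B := by
    ext x
    simp [B, hA]
  have h0 : volume B ≠ 0 :=
    (hB.measure_pos volume ⟨0, by simp [B, paramSqNorm, sqNorm]⟩).ne'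
  have hfin : volume B ≠ ∞ := by
    refine (Bornology.IsBounded.measure_lt_top (Metric.isBounded_closedBall.subset
      (t := Metric.closedBall (0 : BdryParam n) 1) fun x hx => ?_)).ne
    have h1 := (norm_sq_le_paramSqNorm x).trans (le_of_lt hx)
    rw [mem_closedBall_zero_iff]
    exact (sq_le_one_iff₀ (norm_nonneg _)).1 h1
  have hval : volume B = c * volume B := by
    conv_lhs => rw [← hpre]
    rw [← Measure.map_apply A.continuous_of_finiteDimensional.measurable hB.measurableSet, hmap]
    rfl
  have hc : c = 1 := by
    rw [← ENNReal.mul_left_inj h0 hfin, one_mul, ← hval]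
  rw [hmap, hc, one_smul]

/-! ### The four families of symmetries -/

section Families

variable {n : ℕ}

/-! ### Translations -/

/-- The defining function `Re q₁ - |q'|²` is invariant: the term `2 Re ⟨p', q'⟩` is exactly the
cross term of `|q' + p'|²`. This handles both the half space and its boundary. -/
theorem re_translate_fst {p : QSpace n} (hp : p ∈ bdry n) (q : QSpace n) :
    (translate p q).1.re = q.1.re - sqNorm q.2 + sqNorm (translate p q).2 := by
  have h : p.1.re = sqNorm p.2 := hp
  simp only [translate, sqNorm_add]
  simp [h, two_mul]
  ring

/-- The linear part of a translation. -/
noncomputable def translateLinear (p : QSpace n) : QSpace n →ₗ[ℝ] QSpace n where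
  toFun q := (q.1 + 2 * hInner p.2 q.2, q.2)
  map_add' q r := by
    simp only [Prod.fst_add, Prod.snd_add, hInner_add_right, Prod.mk_add_mk, mul_add]
    congr 1
    abel
  map_smul' c q := by
    simp only [Prod.smul_fst, Prod.smul_snd, hInner_smul_right, RingHom.id_apply, Prod.smul_mk,
      smul_add, mul_smul_comm]

theorem isFueterN_one_comp {L : QSpace n →ₗ[ℝ] ℍ[ℝ]} {A : QSpace n →ₗ[ℝ] QSpace n}
    (h : IsFueterN (L ∘ₗ A)) : IsFueterN (LinearMap.mulLeft ℝ 1 ∘ₗ L ∘ₗ A) := by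
  rwa [LinearMap.mulLeft_one, LinearMap.id_comp]

/-- The variable `q_k` enters the first coordinate through the left multiplication by `2 conj(p_k)`,
which preserves the Fueter equation. -/
theorem isFueterN_comp_translateLinear (p : QSpace n) {L : QSpace n →ₗ[ℝ] ℍ[ℝ]}
    (hL : IsFueterN L) : IsFueterN (L ∘ₗ translateLinear p) := by
  refine ⟨?_, fun k => ?_⟩
  · have h : translateLinear p ∘ₗ inclFst n = inclFst n := LinearMap.ext fun x => by
      simp [translateLinear, inclFst_apply, hInner_zero_right]
    rw [LinearMap.comp_assoc, h]
    exact hL.1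
  · have h : translateLinear p ∘ₗ inclSnd n k =
        inclFst n ∘ₗ LinearMap.mulLeft ℝ (2 * star (p.2 k)) + inclSnd n k :=
      LinearMap.ext fun x => by
        simp [translateLinear, inclFst_apply, inclSnd_apply, hInner_single_right]
    rw [LinearMap.comp_assoc, h, LinearMap.comp_add, ← LinearMap.comp_assoc]
    exact (hL.1.comp_mulLeft _).add (hL.2 k)

/-- The map induced by a translation on the parameter space of the boundary. -/
noncomputable def translateParam (p : QSpace n) (x : BdryParam n) : BdryParam n :=
  (x.1 + ![(p.1 + 2 * hInner p.2 x.2).imI, (p.1 + 2 * hInner p.2 x.2).imJ,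
    (p.1 + 2 * hInner p.2 x.2).imK], x.2 + p.2)

theorem translate_bdryParam {p : QSpace n} (hp : p ∈ bdry n) (x : BdryParam n) :
    translate p (bdryParam n x) = bdryParam n (translateParam p x) := by
  have h := re_translate_fst hp (bdryParam n x)
  refine Prod.ext ?_ rfl
  ext
  · rw [h]
    simp [bdryParam, translateParam, translate]
  · simp [bdryParam, translateParam, translate, add_assoc]
    rfl
  · simp [bdryParam, translateParam, translate, add_assoc]
    rfl
  · simp [bdryParam, translateParam, translate, add_assoc]
    rfl

theorem measurePreserving_translateParam (p : QSpace n) :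
    MeasurePreserving (translateParam p) volume volume := by
  set c : (Fin (n - 1) → ℍ[ℝ]) → Fin 3 → ℝ := fun y => ![(p.1 + 2 * hInner p.2 y).imI,
    (p.1 + 2 * hInner p.2 y).imJ, (p.1 + 2 * hInner p.2 y).imK]
  have hc : Continuous c := by
    have h0 : Continuous fun y => p.1 + 2 * hInner p.2 y :=
      continuous_const.add (continuous_const.mul (continuous_hInner p.2))
    refine continuous_pi fun i => ?_
    fin_cases i
    · exact Quaternion.continuous_imI.comp h0
    · exact Quaternion.continuous_imJ.comp h0
    · exact Quaternion.continuous_imK.comp h0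
  -- A shear: the fibre `ℝ³` over `y` is translated by a vector depending on `y` alone. The factors
  -- are swapped so that the base comes first.
  have h1 : MeasurePreserving (fun z : (Fin (n - 1) → ℍ[ℝ]) × (Fin 3 → ℝ) =>
      (z.1 + p.2, z.2 + c z.1)) (volume.prod volume) (volume.prod volume) :=
    (measurePreserving_add_right volume p.2).skew_product (g := fun y x => x + c y)
      ((continuous_snd.add (hc.comp continuous_fst)).measurable)
      (Eventually.of_forall fun y => (measurePreserving_add_right volume (c y)).map_eq)
  exact (Measure.measurePreserving_swap.comp h1).comp Measure.measurePreserving_swap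

theorem isSymmetry_translate {p : QSpace n} (hp : p ∈ bdry n) :
    IsSymmetry (translate p) 1 1 1 where
  affine := by
    refine ⟨translateLinear p, fun q => ?_, fun L hL =>
      isFueterN_one_comp (isFueterN_comp_translateLinear p hL)⟩
    simp only [translate, translateLinear, LinearMap.coe_mk, AddHom.coe_mk, Prod.fst_zero,
      Prod.snd_zero, hInner_zero_right, mul_zero, zero_add, add_zero, Prod.mk_add_mk]
    congr 1
    abel
  mapsTo q hq := by
    have h : sqNorm q.2 < q.1.re := hq
    change sqNorm _ < _
    rw [re_translate_fst hp]
    linarith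
  scale_pos := one_pos
  vert q ε := by
    simp only [translate, Prod.fst_add, Prod.snd_add, add_zero, one_mul, Prod.mk_add_mk]
    congr 1
    abel
  map_β := by
    have hm := measurePreserving_translateParam p
    have hφ : Continuous (translate p) := by
      have := (continuous_hInner p.2).comp (continuous_snd (X := ℍ[ℝ]))
      simp only [Function.comp_def] at this
      unfold translate
      fun_prop
    refine map_β_of_semiconj hφ.measurable hm.measurable (translate_bdryParam hp) ?_
    rw [hm.map_eq, ENNReal.ofReal_one, one_smul]

/-- The inverse of a boundary point for the Heisenberg group law. -/
noncomputable def bdryInv (p : QSpace n) : QSpace n := (star p.1, -p.2)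

theorem bdryInv_mem {p : QSpace n} (hp : p ∈ bdry n) : bdryInv p ∈ bdry n := by
  have h : p.1.re = sqNorm p.2 := hp
  simp [bdry, bdryInv, h, sqNorm]

theorem bdryInv_bdryInv (p : QSpace n) : bdryInv (bdryInv p) = p := by simp [bdryInv]

/-- In the first coordinate, `p₁ + conj(p₁) = 2|p'|²` on the boundary cancels `-2⟨p', p'⟩`. -/
theorem translate_bdryInv_translate {p : QSpace n} (hp : p ∈ bdry n) (q : QSpace n) :
    translate (bdryInv p) (translate p q) = q := by
  have h : p.1.re = sqNorm p.2 := hp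
  refine Prod.ext ?_ (by simp [translate, bdryInv])
  simp only [translate, bdryInv, hInner_neg_left, hInner_add_right, hInner_self]
  ext <;> simp [h, two_mul] <;> ring

/-! ### Rotations by unitary matrices -/

/-- The linear map `(q₁, q') ↦ (q₁, 𝐚 q')`. -/
noncomputable def rotMatrixLinear {E : Type*} [AddCommGroup E] [Module ℝ E] {m : ℕ}
    (a : Matrix (Fin m) (Fin m) ℍ[ℝ]) : E × (Fin m → ℍ[ℝ]) →ₗ[ℝ] E × (Fin m → ℍ[ℝ]) where
  toFun q := (q.1, a.mulVec q.2)
  map_add' q r := by simp [Matrix.mulVec_add]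
  map_smul' c q := by simp [Matrix.mulVec_smul]

theorem sum_inclSnd (v : Fin (n - 1) → ℍ[ℝ]) : ∑ l, inclSnd n l (v l) = (0, v) := by
  have h : ∑ l, inclSnd n l (v l) = LinearMap.inr ℝ ℍ[ℝ] _ (∑ l, Pi.single l (v l)) := by
    rw [map_sum]
    rfl
  rw [h, Finset.univ_sum_single]
  rfl

/-- Matrix entries multiply the variables from the left, so each restriction is a sum of maps
covered by `IsFueter.comp_mulLeft`. -/
theorem isFueterN_comp_rotMatrixLinear (a : Matrix (Fin (n - 1)) (Fin (n - 1)) ℍ[ℝ])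
    {L : QSpace n →ₗ[ℝ] ℍ[ℝ]} (hL : IsFueterN L) : IsFueterN (L ∘ₗ rotMatrixLinear a) := by
  refine ⟨?_, fun k => ?_⟩
  · have h : rotMatrixLinear a ∘ₗ inclFst n = inclFst n := LinearMap.ext fun x => by
      simp [rotMatrixLinear, inclFst_apply]
    rw [LinearMap.comp_assoc, h]
    exact hL.1
  · have h : L ∘ₗ rotMatrixLinear a ∘ₗ inclSnd n k =
        ∑ l, (L ∘ₗ inclSnd n l) ∘ₗ LinearMap.mulLeft ℝ (a l k) := LinearMap.ext fun x => by
      have h1 : rotMatrixLinear a (inclSnd n k x) = (0, fun l => a l k * x) := by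
        simp only [rotMatrixLinear, inclSnd_apply, LinearMap.coe_mk, AddHom.coe_mk,
          Matrix.mulVec_single]
        rfl
      simp only [LinearMap.comp_apply, h1, LinearMap.sum_apply, LinearMap.mulLeft_apply]
      rw [← map_sum, sum_inclSnd]
    rw [LinearMap.comp_assoc, h]
    exact IsFueter.sum _ fun l _ => (hL.2 l).comp_mulLeft _

theorem isSymmetry_rotMatrix {a : Matrix (Fin (n - 1)) (Fin (n - 1)) ℍ[ℝ]} (ha : a ∈ Sp (n - 1)) :
    IsSymmetry (n := n) (rotMatrix a) 1 1 1 where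
  affine := by
    refine ⟨rotMatrixLinear a, fun q => ?_, fun L hL =>
      isFueterN_one_comp (isFueterN_comp_rotMatrixLinear a hL)⟩
    simp [rotMatrix, rotMatrixLinear]
  mapsTo q hq := by
    have h : sqNorm q.2 < q.1.re := hq
    change sqNorm (a.mulVec q.2) < q.1.re
    rwa [sqNorm_mulVec ha]
  scale_pos := one_pos
  vert q ε := by simp [rotMatrix]
  map_β := by
    refine map_β_of_semiconj (g := rotMatrixLinear a)
      (rotMatrixLinear a : QSpace n →ₗ[ℝ] QSpace n).continuous_of_finiteDimensional.measurable
      (rotMatrixLinear a : BdryParam n →ₗ[ℝ] _).continuous_of_finiteDimensional.measurable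
      (fun x => ?_) ?_
    · simp [rotMatrix, rotMatrixLinear, bdryParam, sqNorm_mulVec ha]
    · rw [map_volume_of_paramSqNorm _ fun x => ?_, ENNReal.ofReal_one, one_smul]
      simp [paramSqNorm, rotMatrixLinear, sqNorm_mulVec ha]

theorem rotMatrix_rotMatrix {a b : Matrix (Fin (n - 1)) (Fin (n - 1)) ℍ[ℝ]} (h : b * a = 1)
    (q : QSpace n) : rotMatrix b (rotMatrix a q) = q := by
  simp [rotMatrix, h]

/-! ### Rotations by unit quaternions -/

theorem normSq_eq_one_of_norm {σ : ℍ[ℝ]} (hσ : ‖σ‖ = 1) :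
    σ.re ^ 2 + σ.imI ^ 2 + σ.imJ ^ 2 + σ.imK ^ 2 = 1 := by
  rw [← norm_sq_quaternion, hσ, one_pow]

theorem star_mul_self_of_norm {σ : ℍ[ℝ]} (hσ : ‖σ‖ = 1) : star σ * σ = 1 := by
  rw [Quaternion.star_mul_self, Quaternion.normSq_eq_norm_mul_self, hσ]
  simp

theorem re_conj_of_norm {σ : ℍ[ℝ]} (hσ : ‖σ‖ = 1) (x : ℍ[ℝ]) : (star σ * x * σ).re = x.re := by
  have h := normSq_eq_one_of_norm hσ
  simp
  linear_combination x.re * h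

/-- The linear map `R_σ`. -/
noncomputable def rotUnitLinear (σ : ℍ[ℝ]) : QSpace n →ₗ[ℝ] QSpace n where
  toFun q := rotUnit σ q
  map_add' q r := by
    simp only [rotUnit, Prod.fst_add, Prod.snd_add, mul_add, add_mul, Pi.add_apply, Prod.mk_add_mk]
    rfl
  map_smul' c q := by
    simp only [rotUnit, Prod.smul_fst, Prod.smul_snd, mul_smul_comm, smul_mul_assoc, Pi.smul_apply,
      Prod.smul_mk, RingHom.id_apply]
    rfl

/-- Left multiplication by `conj(σ)` in the first variable is harmless; right multiplication by `σ`,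
present in every variable, is compensated by the left factor `σ`. -/
theorem isFueterN_mul_comp_rotUnitLinear (σ : ℍ[ℝ]) {L : QSpace n →ₗ[ℝ] ℍ[ℝ]}
    (hL : IsFueterN L) : IsFueterN (LinearMap.mulLeft ℝ σ ∘ₗ L ∘ₗ rotUnitLinear σ) := by
  refine ⟨?_, fun k => ?_⟩
  · have h : rotUnitLinear σ ∘ₗ inclFst n =
        inclFst n ∘ₗ LinearMap.mulLeft ℝ (star σ) ∘ₗ LinearMap.mulRight ℝ σ :=
      LinearMap.ext fun x => by
        simp only [rotUnitLinear, rotUnit, inclFst_apply, LinearMap.comp_apply, LinearMap.coe_mk,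
          AddHom.coe_mk, LinearMap.mulLeft_apply, LinearMap.mulRight_apply, Pi.zero_apply,
          zero_mul, mul_assoc]
        rfl
    rw [LinearMap.comp_assoc, LinearMap.comp_assoc, h]
    exact (hL.1.comp_mulLeft (star σ)).mul_comp_mulRight σ
  · have h : rotUnitLinear σ ∘ₗ inclSnd n k = inclSnd n k ∘ₗ LinearMap.mulRight ℝ σ :=
      LinearMap.ext fun x => by
        simp only [rotUnitLinear, rotUnit, inclSnd_apply, LinearMap.comp_apply, LinearMap.coe_mk,
          AddHom.coe_mk, LinearMap.mulRight_apply, mul_zero, zero_mul]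
        refine Prod.ext rfl (funext fun j => ?_)
        by_cases hj : j = k
        · subst hj; simp
        · simp [hj]
    rw [LinearMap.comp_assoc, LinearMap.comp_assoc, h]
    exact (hL.2 k).mul_comp_mulRight σ

/-- The map induced by `R_σ` on the parameter space of the boundary. -/
noncomputable def rotUnitParam (σ : ℍ[ℝ]) : BdryParam n →ₗ[ℝ] BdryParam n where
  toFun x := (![(star σ * quat 0 (x.1 0) (x.1 1) (x.1 2) * σ).imI,
    (star σ * quat 0 (x.1 0) (x.1 1) (x.1 2) * σ).imJ,
    (star σ * quat 0 (x.1 0) (x.1 1) (x.1 2) * σ).imK], fun k => x.2 k * σ)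
  map_add' x y := by
    refine Prod.ext (funext fun i => ?_) (funext fun k => ?_)
    · fin_cases i <;> simp <;> ring
    · simp [add_mul]
  map_smul' c x := by
    refine Prod.ext (funext fun i => ?_) (funext fun k => ?_)
    · fin_cases i <;> simp <;> ring
    · simp

theorem rotUnit_bdryParam {σ : ℍ[ℝ]} (hσ : ‖σ‖ = 1) (x : BdryParam n) :
    rotUnit σ (bdryParam n x) = bdryParam n (rotUnitParam σ x) := by
  refine Prod.ext ?_ rfl
  simp only [rotUnit, bdryParam, rotUnitParam, LinearMap.coe_mk, AddHom.coe_mk,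
    sqNorm_mul_right _ hσ]
  ext
  · rw [re_conj_of_norm hσ]
    simp
  all_goals simp; ring

/-- Conjugation by a unit quaternion preserves both norm and real part, hence the length of the
imaginary part. -/
theorem paramSqNorm_rotUnitParam {σ : ℍ[ℝ]} (hσ : ‖σ‖ = 1) (x : BdryParam n) :
    paramSqNorm (rotUnitParam σ x) = paramSqNorm x := by
  have h1 : ‖star σ * quat 0 (x.1 0) (x.1 1) (x.1 2) * σ‖ ^ 2 =
      ‖quat 0 (x.1 0) (x.1 1) (x.1 2)‖ ^ 2 := by simp [hσ]
  rw [norm_sq_quaternion, norm_sq_quaternion, re_conj_of_norm hσ] at h1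
  simp only [quat_re, quat_imI, quat_imJ, quat_imK] at h1
  simp only [paramSqNorm, rotUnitParam, LinearMap.coe_mk, AddHom.coe_mk, sqNorm_mul_right _ hσ,
    Fin.sum_univ_three, Matrix.cons_val]
  linarith

theorem isSymmetry_rotUnit {σ : ℍ[ℝ]} (hσ : ‖σ‖ = 1) :
    IsSymmetry (n := n) (rotUnit σ) 1 1 σ where
  affine := by
    refine ⟨rotUnitLinear σ, fun q => ?_, fun L hL => isFueterN_mul_comp_rotUnitLinear σ hL⟩
    have h : rotUnit σ (0 : QSpace n) = 0 := (rotUnitLinear σ).map_zero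
    rw [h, add_zero]
    rfl
  mapsTo q hq := by
    have h : sqNorm q.2 < q.1.re := hq
    change sqNorm (fun k => q.2 k * σ) < (star σ * q.1 * σ).re
    rwa [sqNorm_mul_right _ hσ, re_conj_of_norm hσ]
  scale_pos := one_pos
  vert q ε := by
    have h : rotUnit σ (((ε : ℍ[ℝ]), 0) : QSpace n) = ((ε : ℍ[ℝ]), 0) := by
      refine Prod.ext ?_ (by ext1; simp [rotUnit])
      simp only [rotUnit]
      rw [← Quaternion.coe_commutes, mul_assoc, star_mul_self_of_norm hσ, mul_one]
    rw [one_mul]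
    nth_rewrite 2 [← h]
    exact (rotUnitLinear σ).map_add _ _
  map_β := by
    refine map_β_of_semiconj
      (rotUnitLinear σ : QSpace n →ₗ[ℝ] QSpace n).continuous_of_finiteDimensional.measurable
      (rotUnitParam σ).continuous_of_finiteDimensional.measurable (rotUnit_bdryParam hσ) ?_
    rw [map_volume_of_paramSqNorm _ (paramSqNorm_rotUnitParam hσ), ENNReal.ofReal_one, one_smul]

theorem rotUnit_rotUnit {σ τ : ℍ[ℝ]} (h : σ * τ = 1) (h' : star τ * star σ = 1)
    (q : QSpace n) : rotUnit τ (rotUnit σ q) = q := by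
  refine Prod.ext ?_ (funext fun k => by simp [rotUnit, mul_assoc, h])
  simp only [rotUnit]
  rw [show star τ * (star σ * q.1 * σ) * τ = (star τ * star σ) * q.1 * (σ * τ) by
    simp only [mul_assoc], h, h', one_mul, mul_one]

/-! ### Dilations -/

/-- The linear map `δ_r`. -/
noncomputable def dilateLinear (r : ℝ) : QSpace n →ₗ[ℝ] QSpace n :=
  LinearMap.prodMap (r ^ 2 • LinearMap.id) (r • LinearMap.id)

theorem isFueterN_comp_dilateLinear (r : ℝ) {L : QSpace n →ₗ[ℝ] ℍ[ℝ]} (hL : IsFueterN L) :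
    IsFueterN (L ∘ₗ dilateLinear r) := by
  refine ⟨?_, fun k => ?_⟩
  · have h : L ∘ₗ dilateLinear r ∘ₗ inclFst n = r ^ 2 • (L ∘ₗ inclFst n) :=
      LinearMap.ext fun x => by
        simp only [LinearMap.comp_apply, LinearMap.smul_apply, ← map_smul]
        simp [dilateLinear, inclFst_apply]
    rw [LinearMap.comp_assoc, h]
    exact hL.1.smul _
  · have h : L ∘ₗ dilateLinear r ∘ₗ inclSnd n k = r • (L ∘ₗ inclSnd n k) :=
      LinearMap.ext fun x => by
        simp only [LinearMap.comp_apply, LinearMap.smul_apply, ← map_smul]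
        simp [dilateLinear, inclSnd_apply]
    rw [LinearMap.comp_assoc, h]
    exact (hL.2 k).smul _

theorem map_volume_dilate (hn : 1 ≤ n) {r : ℝ} (hr : 0 < r) :
    (volume : Measure (BdryParam n)).map (Prod.map (r ^ 2 • ·) (r • ·)) =
      ENNReal.ofReal (r ^ (4 * n + 2))⁻¹ • volume := by
  rw [Measure.volume_eq_prod, ← Measure.map_prod_map _ _ (by fun_prop) (by fun_prop),
    Measure.map_addHaar_smul _ (by positivity), Measure.map_addHaar_smul _ hr.ne',
    Measure.prod_smul_left, Measure.prod_smul_right, smul_smul,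
    ← ENNReal.ofReal_mul (abs_nonneg _), abs_of_pos (by positivity), abs_of_pos (by positivity),
    ← mul_inv, ← pow_mul, ← pow_add, Module.finrank_fin_fun, Module.finrank_pi_fintype]
  simp only [Quaternion.finrank_eq_four, Finset.sum_const, Finset.card_univ, Fintype.card_fin,
    smul_eq_mul]
  -- The subtraction is truncated, so `1 ≤ n` is used here.
  rw [show 2 * 3 + (n - 1) * 4 = 4 * n + 2 by omega]

theorem isSymmetry_dilate (hn : 1 ≤ n) {r : ℝ} (hr : 0 < r) :
    IsSymmetry (n := n) (dilate r) (r ^ 2) (r ^ (4 * n + 2))⁻¹ 1 where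
  affine := by
    refine ⟨dilateLinear r, fun q => ?_, fun L hL =>
      isFueterN_one_comp (isFueterN_comp_dilateLinear r hL)⟩
    simp [dilate, dilateLinear]
  mapsTo q hq := by
    have h : sqNorm q.2 < q.1.re := hq
    change sqNorm (r • q.2) < (r ^ 2 • q.1).re
    rw [sqNorm_smul, Quaternion.re_smul, smul_eq_mul]
    gcongr
  scale_pos := by positivity
  vert q ε := by
    refine Prod.ext ?_ (by simp [dilate])
    simp only [dilate, Prod.fst_add, smul_add, Quaternion.coe_mul, Quaternion.coe_mul_eq_smul]
  map_β := by
    refine map_β_of_semiconj (g := Prod.map (r ^ 2 • ·) (r • ·))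
      (dilateLinear r : QSpace n →ₗ[ℝ] QSpace n).continuous_of_finiteDimensional.measurable
      (by fun_prop) (fun x => ?_) (map_volume_dilate hn hr)
    refine Prod.ext ?_ rfl
    ext <;> simp [dilate, bdryParam, sqNorm_smul]

theorem dilate_dilate {r t : ℝ} (h : t * r = 1) (q : QSpace n) : dilate t (dilate r q) = q := by
  simp [dilate, smul_smul, ← mul_pow, h]

end Families

end QSiegel

theorem mainTheorem5 (n : ℕ) (hn : 1 ≤ n) (q Q : QSpace n)
    (hq : q ∈ QSiegel.upperHalfSpace n) (hQ : Q ∈ QSiegel.upperHalfSpace n) :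
    (∀ p ∈ QSiegel.bdry n,
      QSiegel.cauchySzegoKernel n (QSiegel.translate p q) (QSiegel.translate p Q)
        = QSiegel.cauchySzegoKernel n q Q) ∧
    (∀ a ∈ QSiegel.Sp (n - 1),
      QSiegel.cauchySzegoKernel n (QSiegel.rotMatrix a q) (QSiegel.rotMatrix a Q)
        = QSiegel.cauchySzegoKernel n q Q) ∧
    (∀ σ : Quaternion ℝ, ‖σ‖ = 1 →
      σ * QSiegel.cauchySzegoKernel n (QSiegel.rotUnit σ q) (QSiegel.rotUnit σ Q) * star σ
        = QSiegel.cauchySzegoKernel n q Q) ∧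
    (∀ r : ℝ, 0 < r →
      QSiegel.cauchySzegoKernel n (QSiegel.dilate r q) (QSiegel.dilate r Q)
          * ((r ^ (4 * n + 2) : ℝ) : Quaternion ℝ)
        = QSiegel.cauchySzegoKernel n q Q) := by
  refine ⟨fun p hp => ?_, fun a ha => ?_, fun σ hσ => ?_, fun r hr => ?_⟩
  · have h' := QSiegel.isSymmetry_translate (QSiegel.bdryInv_mem hp)
    -- The inverse symmetry must carry the factor `u⁻¹`, here `1⁻¹`.
    rw [← inv_one (G := ℍ[ℝ])] at h'
    have h := QSiegel.cauchySzegoKernel_transform (QSiegel.isSymmetry_translate hp) h'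
      (QSiegel.translate_bdryInv_translate hp) (fun x => by
        have := QSiegel.translate_bdryInv_translate (QSiegel.bdryInv_mem hp) x
        rwa [QSiegel.bdryInv_bdryInv] at this) one_pos norm_one hq hQ
    simpa using h
  · have h' := QSiegel.isSymmetry_rotMatrix (Unitary.star_mem ha)
    rw [← inv_one (G := ℍ[ℝ])] at h'
    have h := QSiegel.cauchySzegoKernel_transform (QSiegel.isSymmetry_rotMatrix ha) h'
      (QSiegel.rotMatrix_rotMatrix (Unitary.star_mul_self_of_mem ha))
      (QSiegel.rotMatrix_rotMatrix (Unitary.mul_star_self_of_mem ha)) one_pos norm_one hq hQ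
    simpa using h
  · have h0 : σ ≠ 0 := norm_ne_zero_iff.1 (by simp [hσ])
    have h1 : star σ * σ = 1 := QSiegel.star_mul_self_of_norm hσ
    have h2 : σ * star σ = 1 := by rw [QSiegel.star_eq_inv_of_norm_eq_one hσ, mul_inv_cancel₀ h0]
    have h' := QSiegel.isSymmetry_rotUnit (n := n) (σ := star σ) (by rwa [norm_star])
    have h := QSiegel.cauchySzegoKernel_transform (QSiegel.isSymmetry_rotUnit hσ)
      (by rw [← QSiegel.star_eq_inv_of_norm_eq_one hσ]; exact h')
      (QSiegel.rotUnit_rotUnit h2 (by rwa [star_star]))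
      (QSiegel.rotUnit_rotUnit h1 (by rwa [star_star])) one_pos hσ hq hQ
    simpa using h
  · have h' := QSiegel.isSymmetry_dilate hn (inv_pos.2 hr)
    rw [← inv_one (G := ℍ[ℝ])] at h'
    have h := QSiegel.cauchySzegoKernel_transform (QSiegel.isSymmetry_dilate hn hr) h'
      (QSiegel.dilate_dilate (inv_mul_cancel₀ hr.ne'))
      (QSiegel.dilate_dilate (mul_inv_cancel₀ hr.ne')) (by positivity) norm_one hq hQ
    -- Here `κ⁻¹ = r^(4n+2)`, since `κ` is the inverse Jacobian of the dilation.
    simpa only [inv_inv, one_mul, star_one, mul_one] using h
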